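/- **Proposition.** Semilattices are join-semilattices $(S,+,0)$ with a least element $0$. A *weak contact relation* on a poset $P$ with least element $0$ is a symmetric reflexive relation $\delta$ on $P\setminus\{0\}$ such that $a\mathrel\delta b$, $a\le a_1$ and $b\le b_1$ imply $a_1\mathrel\delta b_1$. The *overlap* relation on $P$ is the weak contact relation given by: $a\mathrel\delta b$ if and only if there is $p>0$ with $p\le a$ and $p\le b$. A *weak contact semilattice* (respectively, *weak contact Boolean algebra*) is a semilattice (respectively, Boolean algebra) endowed with a weak contact relation. A weak contact semilattice $\mathbf S$ *embeds* into a weak contact Boolean algebra $\mathbf B$ if there is an injective map $f$ from $S$ to $B$ such that, for all $x,y\in S$, $f(x+y)=f(x)+f(y)$, and $x\mathrel{\delta_S}y$ if and only if $f(x)\mathrel{\delta_B}f(y)$. In ZF, the Zermelo–Fraenkel theory without the Axiom of Choice, the following statements are equivalent; that is, in every model of ZF, if one of them holds then all of them hold. (A) The Prime Ideal Theorem: every nontrivial Boolean algebra has a prime ideal. (B) Every weak contact semilattice that embeds into a weak contact Boolean algebra embeds into a weak contact complete atomic Boolean algebra. (C) Every weak contact semilattice that embeds into a Boolean algebra with the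 overlap relation embeds into a complete atomic Boolean algebra with the overlap relation. -/

import Mathlib

/-! ## Models of ZF

"In ZF, the statements are equivalent" means that ZF entails the equivalences, that is, that they
hold in every model of ZF.  (The membership relation of a model is an arbitrary binary relation.)
All notions below are relativized to such a model `M`: the carriers, operations, relations, maps,
ideals and subsets that are quantified over are elements of `M`. -/

namespace ZFContact

universe u

/-- The only nonlogical symbol of set theory: the binary relation symbol of membership. -/
inductive SetSymb : ℕ → Type
  | mem : SetSymb 2

/-- The first-order language of set theory. -/
def LSet : FirstOrder.Language.{0, 0} := ⟨fun _ => Empty, SetSymb⟩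

/-- The membership relation of a structure for the language of set theory. -/
def Mem {M : Type u} [LSet.Structure M] (x y : M) : Prop :=
  FirstOrder.Language.Structure.RelMap (L := LSet) SetSymb.mem ![x, y]

infix:50 " ∈ₘ " => Mem

/-- `M` is a model of the Zermelo-Fraenkel axioms, without the Axiom of Choice.  The two schemas
range over all first-order formulas of the language of set theory, with parameters from `M`. -/
structure ModelsZF (M : Type u) [LSet.Structure M] : Prop where
  extensionality : ∀ a b : M, (∀ x, x ∈ₘ a ↔ x ∈ₘ b) → a = b
  foundation : ∀ a : M, (∃ x, x ∈ₘ a) → ∃ x, x ∈ₘ a ∧ ∀ y, y ∈ₘ x → ¬ y ∈ₘ a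
  pairing : ∀ a b : M, ∃ c : M, ∀ x, x ∈ₘ c ↔ x = a ∨ x = b
  union : ∀ a : M, ∃ c : M, ∀ x, x ∈ₘ c ↔ ∃ y, y ∈ₘ a ∧ x ∈ₘ y
  powerset : ∀ a : M, ∃ c : M, ∀ x, x ∈ₘ c ↔ ∀ y, y ∈ₘ x → y ∈ₘ a
  infinity : ∃ w : M, (∃ e, e ∈ₘ w ∧ ∀ x, ¬ x ∈ₘ e) ∧
    ∀ x, x ∈ₘ w → ∃ y, y ∈ₘ w ∧ ∀ z, z ∈ₘ y ↔ z ∈ₘ x ∨ z = x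
  separation : ∀ (n : ℕ) (φ : LSet.Formula (Fin (n + 1))) (p : Fin n → M) (a : M),
    ∃ b : M, ∀ x, x ∈ₘ b ↔ x ∈ₘ a ∧ φ.Realize (Fin.cons x p : Fin (n + 1) → M)
  replacement : ∀ (n : ℕ) (φ : LSet.Formula (Fin (n + 2))) (p : Fin n → M) (a : M),
    (∀ x, x ∈ₘ a → ∀ y z : M,
      φ.Realize (Fin.cons x (Fin.cons y p : Fin (n + 1) → M) : Fin (n + 2) → M) →
      φ.Realize (Fin.cons x (Fin.cons z p : Fin (n + 1) → M) : Fin (n + 2) → M) → y = z) →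
    ∃ b : M, ∀ y, y ∈ₘ b ↔
      ∃ x, x ∈ₘ a ∧ φ.Realize (Fin.cons x (Fin.cons y p : Fin (n + 1) → M) : Fin (n + 2) → M)

/-! ## Sets, relations and functions inside a model -/

section Internal

variable {M : Type u} [LSet.Structure M]

/-- The elements, in the sense of the model, of the set `a`. -/
def El (a : M) : Type u := {x : M // x ∈ₘ a}

/-- In the model, `p` is the Kuratowski ordered pair `{{x}, {x, y}}`. -/
def IsPair (p x y : M) : Prop :=
  ∀ w, w ∈ₘ p ↔ (∀ v, v ∈ₘ w ↔ v = x) ∨ (∀ v, v ∈ₘ w ↔ v = x ∨ v = y)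

/-- The collection `s` of elements of `a` is a set of the model. -/
def IsInternalSet {a : M} (s : Set (El a)) : Prop :=
  ∃ c : M, ∀ z, z ∈ₘ c ↔ ∃ x ∈ s, x.1 = z

/-- The relation `r` between elements of `a` and elements of `b` is a set of ordered pairs
of the model. -/
def IsInternalRel {a b : M} (r : El a → El b → Prop) : Prop :=
  ∃ c : M, ∀ z, z ∈ₘ c ↔ ∃ x y, r x y ∧ IsPair z x.1 y.1

/-- The map `f` from `a` to `b` is a function of the model: its graph is a set of the model. -/
def IsInternalMap {a b : M} (f : El a → El b) : Prop :=
  IsInternalRel fun x y => f x = y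

/-- The binary operation `f` on `a` is an operation of the model: the collection of the
`((x, y), f x y)` is a set of the model. -/
def IsInternalOp {a : M} (f : El a → El a → El a) : Prop :=
  ∃ c : M, ∀ z, z ∈ₘ c ↔ ∃ x y p, IsPair p x.1 y.1 ∧ IsPair z p (f x y).1

end Internal

/-! ## Weak contact relations -/

section Contact

variable {P : Type u} [PartialOrder P] [OrderBot P]

/-- A weak contact relation on a poset with minimum `0`: a reflexive and symmetric relation on the
set of nonzero elements that is upward closed in both arguments. -/
structure IsWeakContact (δ : P → P → Prop) : Prop where
  ne_bot : ∀ a b, δ a b → a ≠ ⊥ ∧ b ≠ ⊥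
  refl : ∀ a, a ≠ ⊥ → δ a a
  symm : ∀ a b, δ a b → δ b a
  ext : ∀ a b a₁ b₁, δ a b → a ≤ a₁ → b ≤ b₁ → δ a₁ b₁

/-- The overlap relation on a poset with minimum. -/
def Overlap (a b : P) : Prop := ∃ p : P, ⊥ < p ∧ p ≤ a ∧ p ≤ b

end Contact

/-! ## The structures, inside a model -/

section Structures

variable (M : Type u) [LSet.Structure M]

/-- A weak contact join-semilattice `(S, +, 0, δ)` of the model `M`. -/
structure WCSemilattice where
  carrier : M
  [sup : SemilatticeSup (El carrier)]
  [bot : OrderBot (El carrier)]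
  sup_internal : IsInternalOp fun x y : El carrier => x ⊔ y
  rel : El carrier → El carrier → Prop
  rel_internal : IsInternalRel rel
  rel_contact : IsWeakContact rel

/-- A Boolean algebra `(B, +, ·, ', 0, 1)` of the model `M`. -/
structure BoolAlg where
  carrier : M
  [alg : BooleanAlgebra (El carrier)]
  sup_internal : IsInternalOp fun x y : El carrier => x ⊔ y
  inf_internal : IsInternalOp fun x y : El carrier => x ⊓ y
  compl_internal : IsInternalMap fun x : El carrier => xᶜ

attribute [instance] WCSemilattice.sup WCSemilattice.bot BoolAlg.alg

/-- A weak contact Boolean algebra of the model `M`. -/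
structure WCBoolAlg extends BoolAlg M where
  rel : El carrier → El carrier → Prop
  rel_internal : IsInternalRel rel
  rel_contact : IsWeakContact rel

variable {M}

/-- The Boolean algebra is complete, in the sense of the model: every subset that belongs to the
model has a least upper bound. -/
def BoolAlg.IsComplete (B : BoolAlg M) : Prop :=
  ∀ s : Set (El B.carrier), IsInternalSet s → ∃ b, IsLUB s b

/-- The weak contact relation of the Boolean algebra is its overlap relation. -/
def WCBoolAlg.IsOverlap (B : WCBoolAlg M) : Prop :=
  ∀ x y, B.rel x y ↔ Overlap x y

/-- In the model, there is an embedding of `S` into the `{δ, +}`-reduct of `B`.  (Such a map sends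
`0`, and only `0`, to `0`, since `0` is the only element not in contact with itself.) -/
def WCSemilattice.EmbedsInto (S : WCSemilattice M) (B : WCBoolAlg M) : Prop :=
  ∃ f : El S.carrier → El B.carrier, IsInternalMap f ∧ Function.Injective f ∧
    (∀ x y, f (x ⊔ y) = f x ⊔ f y) ∧ ∀ x y, S.rel x y ↔ B.rel (f x) (f y)

end Structures

/-! ## The three statements, interpreted in a model -/

section Statements

variable (M : Type u) [LSet.Structure M]

/-- The Prime Ideal Theorem holds in `M`: every nontrivial Boolean algebra has a prime ideal. -/
def PrimeIdealTheorem : Prop :=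
  ∀ B : BoolAlg M, Nontrivial (El B.carrier) →
    ∃ I : Order.Ideal (El B.carrier), I.IsPrime ∧ IsInternalSet (I : Set (El B.carrier))

/-- In `M`, every weak contact semilattice that embeds into a weak contact Boolean algebra embeds
into a weak contact complete atomic Boolean algebra. -/
def WeakContactImplication : Prop :=
  ∀ S : WCSemilattice M, (∃ B : WCBoolAlg M, S.EmbedsInto B) →
    ∃ B : WCBoolAlg M, B.IsComplete ∧ IsAtomic (El B.carrier) ∧ S.EmbedsInto B

/-- In `M`, every weak contact semilattice that embeds into a Boolean algebra with overlap contact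
embeds into a complete atomic Boolean algebra with overlap contact. -/
def OverlapContactImplication : Prop :=
  ∀ S : WCSemilattice M, (∃ B : WCBoolAlg M, B.IsOverlap ∧ S.EmbedsInto B) →
    ∃ B : WCBoolAlg M,
      B.IsOverlap ∧ B.IsComplete ∧ IsAtomic (El B.carrier) ∧ S.EmbedsInto B

end Statements

end ZFContact

/-!
The two embedding statements imply the Prime Ideal Theorem by one and the same argument. A nontrivial
Boolean algebra `B` with its overlap relation embeds into itself, hence, by
`WeakContactImplication M` or `OverlapContactImplication M`, there is a join-preserving map `f` from
`B` to an atomic Boolean algebra that preserves and reflects contact.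
Whatever the contact relation of the target is, elements that are not in contact are disjoint, so
`f x` and `f xᶜ` are disjoint, whereas `f ⊤ ≠ ⊥`. If `p` is an atom below `f ⊤`, then
`{x | ¬ p ≤ f x}` is a prime ideal (`BoolAlg.exists_prime_of_embedsInto`).

Conversely, under the Prime Ideal Theorem the Stone map sends `B` into the power set of the set of
its prime ideals, and it is an embedding (`BoolAlg.exists_stone`): a prime ideal that omits a given
`a ≠ ⊥` is obtained by applying the Prime Ideal Theorem to the relative algebra of the elements
below `a` (`BoolAlg.exists_relative`, `BoolAlg.exists_isPrimeIdeal_notMem`). The Stone map preserves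
and reflects overlap, which settles `OverlapContactImplication M`. For `WeakContactImplication M`,
the power set is given the least weak contact relation for which the Stone map preserves contact
(`isWeakContact_generated`); contact is then also reflected.

Everything has to be carried out inside a model `M` of ZF, so each set, relation and operation that
is constructed must be shown to belong to `M`. By separation this reduces to first-order
definability with parameters (`ModelsZF.isInternalSet_iff`, `ModelsZF.isInternalRel_iff`,
`ModelsZF.isInternalMap_iff`, `ModelsZF.isInternalOp_iff`). Definability is treated semantically:
`DefinablePred` and `DefinableMap` are closed under connectives, quantifiers over `M` and over the
elements of a set of `M`, and composition, so no formula is written out beyond the atomic ones.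
Prime ideals of an algebra of `M` and subsets of a set of `M` are themselves elements of `M`, hence
quantifying over them is first-order.
-/

namespace ZFContact
open FirstOrder Language

universe u v w

/-! ### Definable predicates and maps -/

section Definability

variable (M : Type u) [LSet.Structure M]

/-- A type whose elements are represented by elements of `M`, injectively and with definable range:
`M` itself, or the type of elements of a set of `M`. These are the types over which first-order
formulas can quantify. -/
class Coded (A : Type v) where
  code : A → M
  code_injective : Function.Injective code
  definable_range :
    (Set.univ : Set M).Definable LSet {v : Fin 1 → M | v 0 ∈ Set.range code}

/-- A type whose elements are represented by tuples of elements of `M`: the valuations of finitely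
many variables, each ranging over a coded type. Contexts are built as iterated products
`(A × B) × C`; in the tuple the last variable comes first. -/
class Context (Γ : Type v) where
  arity : ℕ
  val : Γ → Fin arity → M

open Coded (code code_injective)

variable {M} in
theorem definable_mem_var {n : ℕ} (i j : Fin n) :
    (Set.univ : Set M).Definable LSet {v : Fin n → M | v i ∈ₘ v j} := by
  rw [Set.definable_iff_exists_formula_sum]
  refine ⟨Relations.formula₂ (L := LSet) SetSymb.mem (.var (.inr i)) (.var (.inr j)), ?_⟩
  ext v
  exact (Formula.realize_rel₂ (L := LSet) (M := M) (R := SetSymb.mem)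
    (v := Sum.elim (fun a : (Set.univ : Set M) => a.1) v)
    (t₁ := .var (.inr i)) (t₂ := .var (.inr j))).symm

variable {M} in
theorem definable_mem_const (a : M) {n : ℕ} (i : Fin n) :
    (Set.univ : Set M).Definable LSet {v : Fin n → M | v i ∈ₘ a} := by
  rw [Set.definable_iff_exists_formula_sum]
  refine ⟨Relations.formula₂ (L := LSet) SetSymb.mem (.var (.inr i)) (.var (.inl ⟨a, trivial⟩)), ?_⟩
  ext v
  exact (Formula.realize_rel₂ (L := LSet) (M := M) (R := SetSymb.mem)
    (v := Sum.elim (fun a : (Set.univ : Set M) => a.1) v)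
    (t₁ := .var (.inr i)) (t₂ := .var (.inl ⟨a, trivial⟩))).symm

variable {M} in
theorem definable_eq_var {n : ℕ} (i j : Fin n) :
    (Set.univ : Set M).Definable LSet {v : Fin n → M | v i = v j} := by
  rw [Set.definable_iff_exists_formula_sum]
  refine ⟨Term.equal (.var (.inr i)) (.var (.inr j)), ?_⟩
  ext v
  simp [Formula.realize_equal]

variable {M} in
theorem definable_eq_const (a : M) {n : ℕ} (i : Fin n) :
    (Set.univ : Set M).Definable LSet {v : Fin n → M | a = v i} := by
  rw [Set.definable_iff_exists_formula_sum]
  refine ⟨Term.equal (.var (.inl ⟨a, trivial⟩)) (.var (.inr i)), ?_⟩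
  ext v
  simp [Formula.realize_equal]

instance : Coded M M := ⟨id, Function.injective_id, by simp⟩

instance (a : M) : Coded M (El a) where
  code x := x.1
  code_injective := Subtype.val_injective
  definable_range := by
    have : {v : Fin 1 → M | v 0 ∈ Set.range (fun x : El a => x.1)} = {v | v 0 ∈ₘ a} := by
      ext v
      exact ⟨fun ⟨x, hx⟩ => (congrArg (· ∈ₘ a) hx).mp x.2, fun h => ⟨⟨_, h⟩, rfl⟩⟩
    rw [this]
    exact definable_mem_const a 0

instance (A : Type v) [Coded M A] : Context M A := ⟨1, fun a _ => Coded.code a⟩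

instance (Γ : Type v) (A : Type w) [Context M Γ] [Coded M A] : Context M (Γ × A) :=
  ⟨Context.arity M Γ + 1, fun p => Fin.cons (Coded.code p.2) (Context.val p.1)⟩

/-- The predicate `P` on a context is given by a first-order formula with parameters from `M`. -/
def DefinablePred {Γ : Type v} [Context M Γ] (P : Γ → Prop) : Prop :=
  ∃ D : Set (Fin (Context.arity M Γ) → M), (Set.univ : Set M).Definable LSet D ∧
    ∀ γ, P γ ↔ Context.val γ ∈ D

/-- The map `t` from a context to a coded type is definable: its graph, with values read in
`M`, is. -/
def DefinableMap {Γ : Type v} {A : Type w} [Context M Γ] [Coded M A] (t : Γ → A) : Prop :=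
  DefinablePred M fun p : Γ × M => Coded.code (t p.1) = p.2

end Definability

section Closure

open Coded (code code_injective)

variable {M : Type u} [LSet.Structure M] {Γ Δ A B C : Type*} [Context M Γ] [Context M Δ]
  [Coded M A] [Coded M B] [Coded M C]

/-- Substitution of variables for variables, described by the map `ρ` on tuple positions. -/
theorem DefinablePred.rename {P : Γ → Prop} (hP : DefinablePred M P) (e : Δ → Γ)
    (ρ : Fin (Context.arity M Γ) → Fin (Context.arity M Δ))
    (h : ∀ δ, (Context.val (e δ) : _ → M) = Context.val δ ∘ ρ) :
    DefinablePred M fun δ => P (e δ) := by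
  obtain ⟨D, hD, hPD⟩ := hP
  refine ⟨_, hD.preimage_comp ρ, fun δ => ?_⟩
  exact (hPD _).trans (by rw [h]; rfl)

theorem DefinablePred.congr {P Q : Γ → Prop} (hP : DefinablePred M P) (h : ∀ γ, Q γ ↔ P γ) :
    DefinablePred M Q := by
  obtain rfl : Q = P := funext fun γ => propext (h γ)
  exact hP

theorem DefinablePred.not {P : Γ → Prop} (hP : DefinablePred M P) :
    DefinablePred M fun γ => ¬ P γ := by
  obtain ⟨D, hD, hPD⟩ := hP
  exact ⟨Dᶜ, hD.compl, fun γ => (hPD γ).not⟩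

theorem DefinablePred.and {P Q : Γ → Prop} (hP : DefinablePred M P) (hQ : DefinablePred M Q) :
    DefinablePred M fun γ => P γ ∧ Q γ := by
  obtain ⟨D, hD, hPD⟩ := hP
  obtain ⟨E, hE, hQE⟩ := hQ
  exact ⟨D ∩ E, hD.inter hE, fun γ => and_congr (hPD γ) (hQE γ)⟩

theorem DefinablePred.or {P Q : Γ → Prop} (hP : DefinablePred M P) (hQ : DefinablePred M Q) :
    DefinablePred M fun γ => P γ ∨ Q γ := by
  obtain ⟨D, hD, hPD⟩ := hP
  obtain ⟨E, hE, hQE⟩ := hQ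
  exact ⟨D ∪ E, hD.union hE, fun γ => or_congr (hPD γ) (hQE γ)⟩

theorem DefinablePred.imp {P Q : Γ → Prop} (hP : DefinablePred M P) (hQ : DefinablePred M Q) :
    DefinablePred M fun γ => P γ → Q γ :=
  (hP.not.or hQ).congr fun _ => imp_iff_not_or

theorem DefinablePred.iff {P Q : Γ → Prop} (hP : DefinablePred M P) (hQ : DefinablePred M Q) :
    DefinablePred M fun γ => P γ ↔ Q γ :=
  ((hP.imp hQ).and (hQ.imp hP)).congr fun _ => iff_iff_implies_and_implies

theorem DefinablePred.exists {P : Γ → A → Prop}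
    (hP : DefinablePred M fun p : Γ × A => P p.1 p.2) : DefinablePred M fun γ => ∃ a, P γ a := by
  obtain ⟨D, hD, hPD⟩ := hP
  have hR := (Coded.definable_range (M := M) (A := A)).preimage_comp
    (fun _ => 0 : Fin 1 → Fin (Context.arity M Γ + 1))
  refine ⟨_, (hD.inter hR).image_comp Fin.succ, fun γ => ⟨?_, ?_⟩⟩
  · rintro ⟨a, ha⟩
    exact ⟨_, ⟨(hPD (γ, a)).1 ha, a, rfl⟩, rfl⟩
  · rintro ⟨v, ⟨hv, a, ha⟩, hvγ⟩
    refine ⟨a, (hPD (γ, a)).2 ?_⟩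
    convert hv
    change Fin.cons _ _ = v
    rw [← hvγ, show code a = v 0 from ha]
    exact Fin.cons_self_tail v

theorem DefinablePred.forall {P : Γ → A → Prop}
    (hP : DefinablePred M fun p : Γ × A => P p.1 p.2) : DefinablePred M fun γ => ∀ a, P γ a :=
  (DefinablePred.exists (P := fun γ a => ¬ P γ a) hP.not).not.congr fun _ => by simp

theorem DefinableMap.snd : DefinableMap M fun p : Γ × A => p.2 :=
  ⟨_, definable_eq_var 1 0, fun _ => Iff.rfl⟩

theorem DefinableMap.id : DefinableMap M fun a : A => a :=
  ⟨_, definable_eq_var 1 0, fun _ => Iff.rfl⟩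

theorem DefinableMap.const (a : A) : DefinableMap M fun _ : Γ => a :=
  ⟨_, definable_eq_const (code a) 0, fun _ => Iff.rfl⟩

theorem DefinableMap.fst {t : Γ → A} (ht : DefinableMap M t) :
    DefinableMap M fun p : Γ × B => t p.1 :=
  DefinablePred.rename ht (fun p : (Γ × B) × M => (p.1.1, p.2))
    (Fin.cons 0 fun i => i.succ.succ) fun _ => by
      funext i
      refine Fin.cases rfl (fun i => rfl) i

/-- The graph of a definable map, as a predicate with the value in the coded type instead of `M`. -/
theorem DefinableMap.eq_snd {t : Γ → A} (ht : DefinableMap M t) :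
    DefinablePred M fun p : Γ × A => t p.1 = p.2 :=
  (DefinablePred.rename ht (fun p : Γ × A => (p.1, (code p.2 : M))) (fun i => i)
    fun _ => rfl).congr fun _ => (code_injective.eq_iff).symm

theorem DefinablePred.comp {P : Γ → A → Prop} {t : Γ → A}
    (hP : DefinablePred M fun p : Γ × A => P p.1 p.2) (ht : DefinableMap M t) :
    DefinablePred M fun γ => P γ (t γ) :=
  (DefinablePred.exists (P := fun γ a => t γ = a ∧ P γ a) (ht.eq_snd.and hP)).congr
    fun _ => by simp

theorem DefinablePred.comp₁ {P : A → Prop} {s : Γ → A}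
    (hP : DefinablePred M P) (hs : DefinableMap M s) : DefinablePred M fun γ => P (s γ) :=
  DefinablePred.comp (P := fun _ a => P a)
    (hP.rename (fun p : Γ × A => p.2) (fun _ => 0) fun _ => rfl) hs

theorem DefinablePred.comp₂ {P : A → B → Prop} {s : Γ → A} {t : Γ → B}
    (hP : DefinablePred M fun p : A × B => P p.1 p.2)
    (hs : DefinableMap M s) (ht : DefinableMap M t) : DefinablePred M fun γ => P (s γ) (t γ) := by
  refine DefinablePred.comp (P := fun γ b => P (s γ) b) ?_ ht
  refine DefinablePred.comp (P := fun (γ : Γ × B) a => P a γ.2) ?_ hs.fst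
  refine hP.rename (fun p : (Γ × B) × A => (p.2, p.1.2))
    (Fin.cons 1 fun _ => 0) fun _ => ?_
  funext i
  refine Fin.cases rfl (fun i => rfl) i

theorem DefinableMap.comp₁ {f : A → B} {s : Γ → A}
    (hf : DefinableMap M f) (hs : DefinableMap M s) : DefinableMap M fun γ => f (s γ) :=
  DefinablePred.comp₂ (P := fun (a : A) (m : M) => code (f a) = m) hf hs.fst .snd

theorem DefinableMap.comp₂ {f : A → B → C} {s : Γ → A} {t : Γ → B}
    (hf : DefinableMap M fun p : A × B => f p.1 p.2)
    (hs : DefinableMap M s) (ht : DefinableMap M t) : DefinableMap M fun γ => f (s γ) (t γ) := by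
  refine DefinablePred.comp (P := fun (γ : Γ × M) b => code (f (s γ.1) b) = γ.2) ?_ ht.fst
  refine DefinablePred.comp (P := fun (γ : (Γ × M) × B) a => code (f a γ.2) = γ.1.2) ?_ hs.fst.fst
  refine DefinablePred.rename hf (fun p : ((Γ × M) × B) × A => ((p.2, p.1.2), p.1.1.2))
    (Fin.cons 2 (Fin.cons 1 fun _ => 0)) fun _ => ?_
  funext i
  refine Fin.cases rfl (fun i => Fin.cases rfl (fun i => rfl) i) i

/-- The graph of `t` is by definition a predicate of the code of its value. -/
theorem DefinableMap.coded {t : Γ → A} (ht : DefinableMap M t) :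
    DefinableMap M fun γ => (code (t γ) : M) := ht

theorem DefinableMap.coe {a : M} {t : Γ → El a} (ht : DefinableMap M t) :
    DefinableMap M fun γ => (t γ).1 := ht

theorem DefinablePred.eq {s t : Γ → A} (hs : DefinableMap M s) (ht : DefinableMap M t) :
    DefinablePred M fun γ => s γ = t γ :=
  DefinablePred.comp (P := fun γ a => s γ = a) hs.eq_snd ht

theorem DefinablePred.mem {s t : Γ → M} (hs : DefinableMap M s) (ht : DefinableMap M t) :
    DefinablePred M fun γ => s γ ∈ₘ t γ :=
  DefinablePred.comp₂ (P := fun x y : M => x ∈ₘ y)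
    ⟨_, definable_mem_var 1 0, fun _ => Iff.rfl⟩ hs ht

/-- A map is definable as soon as its graph is. -/
theorem DefinableMap.of_graph {t : Γ → A} (h : DefinablePred M fun p : Γ × A => t p.1 = p.2) :
    DefinableMap M t := by
  have : DefinablePred M fun p : Γ × M => ∃ a : A, t p.1 = a ∧ code a = p.2 := by
    refine .exists (.and ?_ (.eq DefinableMap.snd.coded DefinableMap.snd.fst))
    refine h.rename (fun p : (Γ × M) × A => (p.1.1, p.2)) (Fin.cons 0 fun i => i.succ.succ)
      fun _ => ?_
    funext i
    refine Fin.cases rfl (fun i => rfl) i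
  exact this.congr fun _ => by simp

theorem DefinablePred.isPair {p s t : Γ → M} (hp : DefinableMap M p) (hs : DefinableMap M s)
    (ht : DefinableMap M t) : DefinablePred M fun γ => IsPair (p γ) (s γ) (t γ) := by
  unfold IsPair
  refine .forall (.iff (.mem .snd hp.fst) (.or (.forall (.iff (.mem .snd DefinableMap.snd.fst)
    (.eq .snd hs.fst.fst))) (.forall (.iff (.mem .snd DefinableMap.snd.fst)
    (.or (.eq .snd hs.fst.fst) (.eq .snd ht.fst.fst))))))

/-- The separation schema for definable predicates. -/
theorem ModelsZF.exists_sep (hM : ModelsZF M) {P : M → Prop} (hP : DefinablePred M P) (a : M) :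
    ∃ b : M, ∀ x, x ∈ₘ b ↔ x ∈ₘ a ∧ P x := by
  obtain ⟨D, hD, hPD⟩ := hP
  obtain ⟨A₀, -, hD⟩ := Set.definable_iff_finitely_definable.1 hD
  obtain ⟨φ, rfl⟩ := Set.definable_iff_exists_formula_sum.1 hD
  let e := A₀.equivFin
  obtain ⟨b, hb⟩ := hM.separation A₀.card
    (φ.relabel (Sum.elim (fun x => (e x).succ) fun _ => 0)) (fun i => (e.symm i).1) a
  refine ⟨b, fun x => (hb x).trans (and_congr_right fun _ => ?_)⟩
  rw [hPD, Formula.realize_relabel]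
  refine Eq.to_iff (congrArg φ.Realize ?_)
  funext i
  rcases i with i | i
  · simp
  · rfl

end Closure

/-! ### Internal sets, relations and operations are the definable ones -/

section Pairs

variable {M : Type u} [LSet.Structure M]

theorem ModelsZF.exists_isPair (hM : ModelsZF M) (x y : M) : ∃ p, IsPair p x y := by
  obtain ⟨s, hs⟩ := hM.pairing x x
  obtain ⟨d, hd⟩ := hM.pairing x y
  obtain ⟨p, hp⟩ := hM.pairing s d
  refine ⟨p, fun w => (hp w).trans (or_congr ⟨?_, fun h => ?_⟩ ⟨?_, fun h => ?_⟩)⟩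
  · rintro rfl v
    simp [hs]
  · exact hM.extensionality _ _ fun v => by simp [hs, h]
  · rintro rfl v
    exact hd v
  · exact hM.extensionality _ _ fun v => by simp [hd, h]

theorem ModelsZF.isPair_inj (hM : ModelsZF M) {p x y x' y' : M} (h : IsPair p x y)
    (h' : IsPair p x' y') : x = x' ∧ y = y' := by
  obtain ⟨s, hs⟩ := hM.pairing x x
  obtain ⟨d, hd⟩ := hM.pairing x y
  obtain ⟨d', hd'⟩ := hM.pairing x' y'
  have hsp : s ∈ₘ p := (h s).2 (.inl fun v => by simp [hs])
  have hdp : d ∈ₘ p := (h d).2 (.inr hd)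
  have hdp' : d' ∈ₘ p := (h' d').2 (.inr hd')
  obtain rfl : x = x' := by
    rcases (h' s).1 hsp with h₁ | h₁
    · simpa [hs, eq_comm] using h₁ x'
    · simpa [hs, eq_comm] using h₁ x'
  refine ⟨rfl, ?_⟩
  have h₁ : y = x ∨ y = y' := by
    rcases (h' d).1 hdp with h₁ | h₁
    · exact .inl ((h₁ y).1 ((hd y).2 (.inr rfl)))
    · exact (h₁ y).1 ((hd y).2 (.inr rfl))
  have h₂ : y' = x ∨ y' = y := by
    rcases (h d').1 hdp' with h₁ | h₁
    · exact .inl ((h₁ y').1 ((hd' y').2 (.inr rfl)))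
    · exact (h₁ y').1 ((hd' y').2 (.inr rfl))
  grind

/-- The pairs with components in `a` and `b` all lie in one set, the double power set of `a ∪ b`;
the product can then be cut out by separation. -/
theorem ModelsZF.exists_pairs_subset (hM : ModelsZF M) (a b : M) :
    ∃ c : M, ∀ x y z, x ∈ₘ a → y ∈ₘ b → IsPair z x y → z ∈ₘ c := by
  obtain ⟨d, hd⟩ := hM.pairing a b
  obtain ⟨u, hu⟩ := hM.union d
  obtain ⟨p, hp⟩ := hM.powerset u
  obtain ⟨c, hc⟩ := hM.powerset p
  refine ⟨c, fun x y z hx hy hz => (hc z).2 fun w hw => (hp w).2 fun v hv => (hu v).2 ?_⟩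
  rcases (hz w).1 hw with h | h
  · exact ⟨a, (hd a).2 (.inl rfl), ((h v).1 hv) ▸ hx⟩
  · rcases (h v).1 hv with rfl | rfl
    · exact ⟨a, (hd a).2 (.inl rfl), hx⟩
    · exact ⟨b, (hd b).2 (.inr rfl), hy⟩

theorem ModelsZF.isInternalSet_iff (hM : ModelsZF M) {a : M} {s : Set (El a)} :
    IsInternalSet s ↔ DefinablePred M (· ∈ s) := by
  constructor
  · rintro ⟨c, hc⟩
    refine (DefinablePred.mem (DefinableMap.id (A := El a)).coe (.const c)).congr fun x => ?_
    exact ⟨fun h => (hc _).2 ⟨x, h, rfl⟩, fun h => by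
      obtain ⟨y, hy, hyx⟩ := (hc _).1 h
      rwa [← Subtype.ext hyx]⟩
  · intro h
    obtain ⟨c, hc⟩ := hM.exists_sep (P := fun z => ∃ x : El a, x ∈ s ∧ x.1 = z)
      (.exists (.and (h.comp₁ .snd) (.eq DefinableMap.snd.coe DefinableMap.id.fst))) a
    refine ⟨c, fun z => (hc z).trans (and_iff_right_of_imp ?_)⟩
    rintro ⟨x, -, rfl⟩
    exact x.2

theorem ModelsZF.isInternalRel_iff (hM : ModelsZF M) {a b : M} {r : El a → El b → Prop} :
    IsInternalRel r ↔ DefinablePred M fun p : El a × El b => r p.1 p.2 := by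
  constructor
  · rintro ⟨c, hc⟩
    have : DefinablePred M fun p : El a × El b => ∃ z : M, z ∈ₘ c ∧ IsPair z p.1.1 p.2.1 :=
      .exists (.and (.mem .snd (.const c))
        (.isPair .snd DefinableMap.id.fst.coe.fst DefinableMap.snd.coe.fst))
    refine this.congr fun p => ⟨fun h => ?_, fun ⟨z, hz, hzp⟩ => ?_⟩
    · obtain ⟨z, hz⟩ := hM.exists_isPair p.1.1 p.2.1
      exact ⟨z, (hc z).2 ⟨_, _, h, hz⟩, hz⟩
    · obtain ⟨x, y, hxy, hz⟩ := (hc z).1 hz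
      obtain ⟨h₁, h₂⟩ := hM.isPair_inj hzp hz
      rwa [Subtype.ext h₁, Subtype.ext h₂]
  · intro h
    obtain ⟨d, hd⟩ := hM.exists_pairs_subset a b
    obtain ⟨c, hc⟩ := hM.exists_sep (P := fun z => ∃ x : El a, ∃ y : El b, r x y ∧ IsPair z x.1 y.1)
      (.exists (.exists (.and (h.comp₂ DefinableMap.snd.fst .snd)
        (.isPair DefinableMap.id.fst.fst DefinableMap.snd.fst.coe DefinableMap.snd.coe)))) d
    refine ⟨c, fun z => (hc z).trans (and_iff_right_of_imp ?_)⟩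
    rintro ⟨x, y, -, hz⟩
    exact hd _ _ _ x.2 y.2 hz

theorem ModelsZF.isInternalMap_iff (hM : ModelsZF M) {a b : M} {f : El a → El b} :
    IsInternalMap f ↔ DefinableMap M f :=
  hM.isInternalRel_iff.trans ⟨.of_graph, fun h => h.eq_snd⟩

theorem ModelsZF.isInternalOp_iff (hM : ModelsZF M) {a : M} {f : El a → El a → El a} :
    IsInternalOp f ↔ DefinableMap M fun p : El a × El a => f p.1 p.2 := by
  constructor
  · rintro ⟨c, hc⟩
    have : DefinablePred M fun p : (El a × El a) × El a =>
        ∃ z q : M, z ∈ₘ c ∧ IsPair q p.1.1.1 p.1.2.1 ∧ IsPair z q p.2.1 :=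
      .exists (.exists (.and (.mem DefinableMap.snd.fst (.const c)) (.and
        (.isPair .snd DefinableMap.id.fst.coe.fst.fst.fst DefinableMap.snd.coe.fst.fst.fst)
        (.isPair DefinableMap.snd.fst .snd DefinableMap.snd.coe.fst.fst))))
    refine .of_graph (this.congr fun p => ⟨fun h => ?_, fun ⟨z, q, hz, hq, hzq⟩ => ?_⟩)
    · obtain ⟨q, hq⟩ := hM.exists_isPair p.1.1.1 p.1.2.1
      obtain ⟨z, hz⟩ := hM.exists_isPair q p.2.1
      exact ⟨z, q, (hc z).2 ⟨_, _, q, hq, h ▸ hz⟩, hq, hz⟩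
    · obtain ⟨x, y, q', hq', hz'⟩ := (hc z).1 hz
      obtain ⟨rfl, h₃⟩ := hM.isPair_inj hzq hz'
      obtain ⟨h₁, h₂⟩ := hM.isPair_inj hq hq'
      rw [Subtype.ext h₁, Subtype.ext h₂, Subtype.ext h₃]
  · intro h
    obtain ⟨d, hd⟩ := hM.exists_pairs_subset a a
    obtain ⟨e, he⟩ := hM.exists_pairs_subset d a
    obtain ⟨c, hc⟩ := hM.exists_sep
      (P := fun z => ∃ x y : El a, ∃ p : M, IsPair p x.1 y.1 ∧ IsPair z p (f x y).1)
      (.exists (.exists (.exists (.and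
        (.isPair .snd DefinableMap.snd.coe.fst.fst DefinableMap.snd.coe.fst)
        (.isPair DefinableMap.id.fst.fst.fst .snd
          (h.comp₂ DefinableMap.snd.fst.fst DefinableMap.snd.fst).coe))))) e
    refine ⟨c, fun z => (hc z).trans (and_iff_right_of_imp ?_)⟩
    rintro ⟨x, y, p, hp, hz⟩
    exact he _ _ _ (hd _ _ _ x.2 y.2 hp) (f x y).2 hz

end Pairs

/-! ### Prime ideals from embeddings into atomic algebras -/

section Algebras

variable {M : Type u} [LSet.Structure M] {Γ : Type*} [Context M Γ]

theorem BoolAlg.definable_sup (B : BoolAlg M) (hM : ModelsZF M) {s t : Γ → El B.carrier}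
    (hs : DefinableMap M s) (ht : DefinableMap M t) : DefinableMap M fun γ => s γ ⊔ t γ :=
  (hM.isInternalOp_iff.1 B.sup_internal).comp₂ hs ht

theorem BoolAlg.definable_inf (B : BoolAlg M) (hM : ModelsZF M) {s t : Γ → El B.carrier}
    (hs : DefinableMap M s) (ht : DefinableMap M t) : DefinableMap M fun γ => s γ ⊓ t γ :=
  (hM.isInternalOp_iff.1 B.inf_internal).comp₂ hs ht

theorem BoolAlg.definable_compl (B : BoolAlg M) (hM : ModelsZF M) {s : Γ → El B.carrier}
    (hs : DefinableMap M s) : DefinableMap M fun γ => (s γ)ᶜ :=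
  (hM.isInternalMap_iff.1 B.compl_internal).comp₁ hs

theorem BoolAlg.definable_le (B : BoolAlg M) (hM : ModelsZF M) {s t : Γ → El B.carrier}
    (hs : DefinableMap M s) (ht : DefinableMap M t) : DefinablePred M fun γ => s γ ≤ t γ :=
  (DefinablePred.eq (B.definable_sup hM hs ht) ht).congr fun _ => sup_eq_right.symm

theorem isWeakContact_overlap {P : Type*} [PartialOrder P] [OrderBot P] :
    IsWeakContact (Overlap (P := P)) where
  ne_bot := fun _ _ ⟨_, hp, ha, hb⟩ => ⟨(hp.trans_le ha).ne', (hp.trans_le hb).ne'⟩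
  refl a ha := ⟨a, bot_lt_iff_ne_bot.2 ha, le_rfl, le_rfl⟩
  symm := fun _ _ ⟨p, hp, ha, hb⟩ => ⟨p, hp, hb, ha⟩
  ext := fun _ _ _ _ ⟨p, hp, ha, hb⟩ ha' hb' => ⟨p, hp, ha.trans ha', hb.trans hb'⟩

theorem overlap_iff_inf_ne_bot {P : Type*} [Lattice P] [OrderBot P] {a b : P} :
    Overlap a b ↔ a ⊓ b ≠ ⊥ :=
  ⟨fun ⟨_, hp, ha, hb⟩ => (hp.trans_le (le_inf ha hb)).ne',
    fun h => ⟨a ⊓ b, bot_lt_iff_ne_bot.2 h, inf_le_left, inf_le_right⟩⟩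

theorem BoolAlg.isInternalRel_overlap (B : BoolAlg M) (hM : ModelsZF M) :
    IsInternalRel (Overlap (P := El B.carrier)) :=
  hM.isInternalRel_iff.2 <| (DefinablePred.not (.eq
    (B.definable_inf hM DefinableMap.id.fst .snd) (.const ⊥))).congr
      fun _ => overlap_iff_inf_ne_bot

/-- A Boolean algebra of `M` as a weak contact algebra with its overlap relation. -/
def BoolAlg.overlapAlg (B : BoolAlg M) (hM : ModelsZF M) : WCBoolAlg M where
  toBoolAlg := B
  rel := Overlap
  rel_internal := B.isInternalRel_overlap hM
  rel_contact := isWeakContact_overlap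

/-- The join-semilattice reduct of a Boolean algebra of `M`, with the overlap relation. -/
def BoolAlg.overlapSemilattice (B : BoolAlg M) (hM : ModelsZF M) : WCSemilattice M where
  carrier := B.carrier
  sup_internal := B.sup_internal
  rel := Overlap
  rel_internal := B.isInternalRel_overlap hM
  rel_contact := isWeakContact_overlap

theorem BoolAlg.overlapSemilattice_embedsInto (B : BoolAlg M) (hM : ModelsZF M) :
    (B.overlapSemilattice hM).EmbedsInto (B.overlapAlg hM) :=
  ⟨id, hM.isInternalMap_iff.2 .id, Function.injective_id, fun _ _ => rfl, fun _ _ => Iff.rfl⟩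

theorem _root_.IsAtom.le_sup_iff {α : Type*} [DistribLattice α] [OrderBot α] {p a b : α}
    (hp : IsAtom p) : p ≤ a ⊔ b ↔ p ≤ a ∨ p ≤ b := by
  refine ⟨fun h => ?_, fun h => h.elim le_sup_of_le_left le_sup_of_le_right⟩
  rcases hp.le_iff.1 (inf_le_left : p ⊓ a ≤ p) with h₁ | h₁
  · refine .inr ?_
    have h₂ : p ⊓ (a ⊔ b) = p := inf_eq_left.2 h
    rw [inf_sup_left, h₁, bot_sup_eq] at h₂
    exact inf_eq_left.1 h₂
  · exact .inl (inf_eq_left.1 h₁)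

/-- The prime ideal consists of the `x` such that `f x` is not above `p`, where `f` is the embedding
and `p` is an atom below `f ⊤`. The contact relation of `C` is arbitrary. -/
theorem BoolAlg.exists_prime_of_embedsInto (B : BoolAlg M) (hM : ModelsZF M)
    [Nontrivial (El B.carrier)] {C : WCBoolAlg M} [IsAtomic (El C.carrier)]
    (h : (B.overlapSemilattice hM).EmbedsInto C) :
    ∃ I : Order.Ideal (El B.carrier), I.IsPrime ∧ IsInternalSet (I : Set (El B.carrier)) := by
  obtain ⟨f, hf, -, hsup, hrel⟩ : ∃ f : El B.carrier → El C.carrier, IsInternalMap f ∧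
      Function.Injective f ∧ (∀ x y, f (x ⊔ y) = f x ⊔ f y) ∧
      ∀ x y, Overlap x y ↔ C.rel (f x) (f y) := h
  have hdisj : ∀ x y : El B.carrier, x ⊓ y = ⊥ → f x ⊓ f y = ⊥ := fun x y hxy => by
    -- A nonzero `f x ⊓ f y` would be in contact with itself, hence `f x` with `f y`.
    by_contra h
    exact overlap_iff_inf_ne_bot.1 ((hrel x y).2
      (C.rel_contact.ext _ _ _ _ (C.rel_contact.refl _ h) inf_le_left inf_le_right)) hxy
  have hbot : f (⊥ : El B.carrier) = ⊥ := by simpa using hdisj ⊥ ⊥ (by simp)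
  have htop : f (⊤ : El B.carrier) ≠ ⊥ := (C.rel_contact.ne_bot _ _
    ((hrel ⊤ ⊤).1 (overlap_iff_inf_ne_bot.2 (by simp)))).1
  obtain ⟨p, hp, hpt⟩ := (eq_bot_or_exists_atom_le _).resolve_left htop
  have hmono : ∀ x y : El B.carrier, x ≤ y → f x ≤ f y := fun x y hxy => by
    rw [← sup_eq_right.2 hxy, hsup]
    exact le_sup_left
  let I : Order.Ideal (El B.carrier) :=
    { carrier := {x | ¬ p ≤ f x}
      lower' := fun x y hyx hx hy => hx (hy.trans (hmono _ _ hyx))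
      nonempty' := ⟨⊥, fun h => hp.1 (le_bot_iff.1 (hbot ▸ h))⟩
      directed' := fun x hx y hy => ⟨x ⊔ y, fun h => by
        rw [hsup, hp.le_sup_iff] at h
        exact h.elim hx hy, le_sup_left, le_sup_right⟩ }
  have : I.IsProper := Order.Ideal.isProper_of_notMem (p := ⊤) fun h => h hpt
  refine ⟨I, Order.Ideal.isPrime_of_mem_or_compl_mem fun {x} => ?_, ?_⟩
  · by_contra! h
    have h₁ : p ≤ f x := not_not.1 h.1
    have h₂ : p ≤ f xᶜ := not_not.1 h.2
    exact hp.1 (le_bot_iff.1 ((le_inf h₁ h₂).trans (hdisj x xᶜ (inf_compl_self x)).le))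
  · exact hM.isInternalSet_iff.2 (DefinablePred.not
      (C.definable_le hM (.const p) ((hM.isInternalMap_iff.1 hf))))

end Algebras

/-! ### The power set algebra of a set of the model -/

section Powerset

variable {M : Type u} [LSet.Structure M]

theorem ModelsZF.exists_subset (hM : ModelsZF M) {a : M} {Q : El a → Prop}
    (hQ : DefinablePred M Q) :
    ∃ b : M, (∀ z, z ∈ₘ b → z ∈ₘ a) ∧ ∀ x : El a, x.1 ∈ₘ b ↔ Q x := by
  obtain ⟨b, hb⟩ := hM.isInternalSet_iff (s := {x | Q x}) |>.2 hQ
  refine ⟨b, fun z hz => ?_, fun x => (hb _).trans ?_⟩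
  · obtain ⟨x, -, rfl⟩ := (hb z).1 hz
    exact x.2
  · exact ⟨fun ⟨y, hy, hyx⟩ => Subtype.ext hyx ▸ hy, fun h => ⟨x, h, rfl⟩⟩

/-- The power set of `X` in the model. -/
noncomputable def ModelsZF.pow (hM : ModelsZF M) (X : M) : M := (hM.powerset X).choose

theorem ModelsZF.mem_pow (hM : ModelsZF M) {X s : M} :
    s ∈ₘ hM.pow X ↔ ∀ x, x ∈ₘ s → x ∈ₘ X :=
  (hM.powerset X).choose_spec s

/-- The subset of `X` of all elements that belong to `s`; here `s` ranges over the elements of `c`,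
which is the power set of `X` in the applications. -/
def extent {X c : M} (s : El c) : Set (El X) := {x | x.1 ∈ₘ s.1}

variable (hM : ModelsZF M) {X : M}

theorem ModelsZF.extent_injective :
    Function.Injective (extent : El (hM.pow X) → Set (El X)) := fun s t h =>
  Subtype.ext <| hM.extensionality _ _ fun x =>
    ⟨fun hx => (Set.ext_iff.1 h ⟨x, hM.mem_pow.1 s.2 _ hx⟩).1 hx,
      fun hx => (Set.ext_iff.1 h ⟨x, hM.mem_pow.1 t.2 _ hx⟩).2 hx⟩

theorem ModelsZF.exists_extent_eq {Q : Set (El X)} (hQ : DefinablePred M (· ∈ Q)) :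
    ∃ s : El (hM.pow X), extent s = Q := by
  obtain ⟨b, hb, hbQ⟩ := hM.exists_subset hQ
  exact ⟨⟨b, hM.mem_pow.2 hb⟩, Set.ext hbQ⟩

/-- The element of the model's power set of `X` whose members form the definable set `Q`. -/
noncomputable def ModelsZF.subset {Q : Set (El X)} (hQ : DefinablePred M (· ∈ Q)) :
    El (hM.pow X) := (hM.exists_extent_eq hQ).choose

theorem ModelsZF.extent_subset {Q : Set (El X)} (hQ : DefinablePred M (· ∈ Q)) :
    extent (hM.subset hQ) = Q := (hM.exists_extent_eq hQ).choose_spec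

theorem DefinablePred.mem_extent {Γ : Type*} [Context M Γ] {X c : M} {t : Γ → El X} {s : Γ → El c}
    (ht : DefinableMap M t) (hs : DefinableMap M s) :
    DefinablePred M fun γ => t γ ∈ extent (s γ) :=
  .mem ht.coe hs.coe

theorem definable_extent {X c : M} (s : El c) : DefinablePred M (· ∈ extent (X := X) s) :=
  .mem_extent .id (.const s)

/-- The Boolean algebra of the subsets of `X` that belong to the model, pulled back along `extent`
from the algebra of all subsets of `El X`. -/
noncomputable abbrev ModelsZF.powBooleanAlgebra (X : M) : BooleanAlgebra (El (hM.pow X)) :=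
  letI : Max (El (hM.pow X)) := ⟨fun s t => hM.subset (Q := extent s ∪ extent t)
    ((definable_extent s).or (definable_extent t))⟩
  letI : Min (El (hM.pow X)) := ⟨fun s t => hM.subset (Q := extent s ∩ extent t)
    ((definable_extent s).and (definable_extent t))⟩
  letI : Compl (El (hM.pow X)) := ⟨fun s => hM.subset (Q := (extent s)ᶜ) (definable_extent s).not⟩
  letI : SDiff (El (hM.pow X)) := ⟨fun s t => hM.subset (Q := extent s \ extent t)
    ((definable_extent s).and (definable_extent t).not)⟩
  letI : HImp (El (hM.pow X)) := ⟨fun s t => hM.subset (Q := extent s ⇨ extent t)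
    (((definable_extent t).or (definable_extent s).not).congr fun _ => by
      simp [himp_eq])⟩
  letI : Top (El (hM.pow X)) := ⟨hM.subset (Q := Set.univ)
    ((DefinablePred.eq .id .id).congr fun x => by simp)⟩
  letI : Bot (El (hM.pow X)) := ⟨hM.subset (Q := ∅)
    ((DefinablePred.eq .id .id).not.congr fun x => by simp)⟩
  letI : LE (El (hM.pow X)) := ⟨fun s t => extent (X := X) s ≤ extent t⟩
  letI : LT (El (hM.pow X)) := ⟨fun s t => extent (X := X) s < extent t⟩
  hM.extent_injective.booleanAlgebra extent Iff.rfl Iff.rfl (fun _ _ => hM.extent_subset _)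
    (fun _ _ => hM.extent_subset _) (hM.extent_subset _) (hM.extent_subset _)
    (fun _ => hM.extent_subset _) (fun _ _ => hM.extent_subset _) (fun _ _ => hM.extent_subset _)

/-- The power set of `X` as a Boolean algebra of the model. -/
noncomputable def ModelsZF.powerAlg (X : M) : BoolAlg M where
  carrier := hM.pow X
  alg := hM.powBooleanAlgebra X
  sup_internal := by
    have : DefinablePred M fun p : (El (hM.pow X) × El (hM.pow X)) × El (hM.pow X) =>
        ∀ x : El X, x ∈ extent p.2 ↔ x ∈ extent p.1.1 ∨ x ∈ extent p.1.2 :=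
      .forall (.iff (.mem_extent .snd DefinableMap.snd.fst) (.or
        (.mem_extent .snd DefinableMap.id.fst.fst.fst)
        (.mem_extent .snd DefinableMap.snd.fst.fst)))
    refine hM.isInternalOp_iff.2 (.of_graph (this.congr fun p => ?_))
    rw [← hM.extent_injective.eq_iff, eq_comm, Set.ext_iff]
    refine forall_congr' fun x => iff_congr Iff.rfl ?_
    exact Set.ext_iff.1 (hM.extent_subset _) x
  inf_internal := by
    have : DefinablePred M fun p : (El (hM.pow X) × El (hM.pow X)) × El (hM.pow X) =>
        ∀ x : El X, x ∈ extent p.2 ↔ x ∈ extent p.1.1 ∧ x ∈ extent p.1.2 :=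
      .forall (.iff (.mem_extent .snd DefinableMap.snd.fst) (.and
        (.mem_extent .snd DefinableMap.id.fst.fst.fst)
        (.mem_extent .snd DefinableMap.snd.fst.fst)))
    refine hM.isInternalOp_iff.2 (.of_graph (this.congr fun p => ?_))
    rw [← hM.extent_injective.eq_iff, eq_comm, Set.ext_iff]
    refine forall_congr' fun x => iff_congr Iff.rfl ?_
    exact Set.ext_iff.1 (hM.extent_subset _) x
  compl_internal := by
    have : DefinablePred M fun p : El (hM.pow X) × El (hM.pow X) =>
        ∀ x : El X, x ∈ extent p.2 ↔ ¬ x ∈ extent p.1 :=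
      .forall (.iff (.mem_extent .snd DefinableMap.snd.fst)
        (.not (.mem_extent .snd DefinableMap.id.fst.fst)))
    refine hM.isInternalMap_iff.2 (.of_graph (this.congr fun p => ?_))
    rw [← hM.extent_injective.eq_iff, eq_comm, Set.ext_iff]
    refine forall_congr' fun x => iff_congr Iff.rfl ?_
    exact Set.ext_iff.1 (hM.extent_subset _) x

theorem ModelsZF.extent_le_iff {s t : El (hM.powerAlg X).carrier} :
    s ≤ t ↔ extent (X := X) s ⊆ extent t := Iff.rfl

theorem ModelsZF.eq_iff_extent {s t : El (hM.powerAlg X).carrier} :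
    s = t ↔ ∀ x : El X, x ∈ extent s ↔ x ∈ extent t := by
  rw [← Set.ext_iff]
  exact hM.extent_injective.eq_iff.symm

theorem ModelsZF.extent_sup (s t : El (hM.powerAlg X).carrier) :
    extent (X := X) (s ⊔ t) = extent s ∪ extent t := hM.extent_subset _

theorem ModelsZF.extent_inf (s t : El (hM.powerAlg X).carrier) :
    extent (X := X) (s ⊓ t) = extent s ∩ extent t := hM.extent_subset _

theorem ModelsZF.extent_bot :
    extent (X := X) (⊥ : El (hM.powerAlg X).carrier) = ∅ := hM.extent_subset _

theorem ModelsZF.eq_bot_iff_extent {s : El (hM.powerAlg X).carrier} :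
    s = ⊥ ↔ extent (X := X) s = ∅ := by
  rw [← hM.extent_bot]
  exact hM.extent_injective.eq_iff.symm

theorem ModelsZF.powerAlg_isComplete : (hM.powerAlg X).IsComplete := by
  intro S hS
  have hS' := hM.isInternalSet_iff.1 hS
  obtain ⟨b, hb⟩ := hM.exists_extent_eq
    (Q := {x : El X | ∃ s : El (hM.pow X), s ∈ S ∧ x ∈ extent s})
    (.exists (.and (hS'.comp₁ .snd) (.mem_extent DefinableMap.id.fst .snd)))
  refine ⟨b, fun s hs x hx => ?_, fun t ht x hx => ?_⟩
  · rw [hb]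
    exact ⟨s, hs, hx⟩
  · rw [hb] at hx
    obtain ⟨s, hs, hx⟩ := hx
    exact ht hs hx

theorem ModelsZF.powerAlg_isAtomic : IsAtomic (El (hM.powerAlg X).carrier) := by
  refine ⟨fun s => or_iff_not_imp_left.2 fun hs => ?_⟩
  rw [hM.eq_bot_iff_extent, ← ne_eq, ← Set.nonempty_iff_ne_empty] at hs
  obtain ⟨x, hx⟩ := hs
  obtain ⟨p, hp⟩ : ∃ p : El (hM.powerAlg X).carrier, extent p = {x} :=
    hM.exists_extent_eq (.eq .id (.const x))
  refine ⟨p, ⟨fun h => ?_, fun t ht => ?_⟩, ?_⟩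
  · rw [hM.eq_bot_iff_extent, hp] at h
    exact Set.singleton_ne_empty x h
  · rw [hM.eq_bot_iff_extent]
    have h : extent (X := X) t ⊂ extent p := ht
    rw [hp, Set.ssubset_singleton_iff] at h
    exact h
  · rw [hM.extent_le_iff, hp]
    exact Set.singleton_subset_iff.2 hx

end Powerset

/-! ### The Stone embedding in a model of the Prime Ideal Theorem -/

section Stone

variable {M : Type u} [LSet.Structure M] (B : BoolAlg M)

/-- The relative algebra `C` of the elements below `a`, with the inclusion `i : C → B` and the
retraction `r x = x ⊓ a`. -/
theorem BoolAlg.exists_relative (hM : ModelsZF M) (a : El B.carrier) :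
    ∃ (C : BoolAlg M) (i : El C.carrier → El B.carrier) (r : El B.carrier → El C.carrier),
      DefinableMap M r ∧ Function.Injective i ∧ (∀ x, i (r x) = x ⊓ a) ∧
      (∀ x y, x ≤ y ↔ i x ≤ i y) ∧ (∀ x, i x ≤ a) := by
  obtain ⟨c, hcB, hc⟩ := hM.exists_subset (Q := fun x : El B.carrier => x ≤ a)
    (B.definable_le hM .id (.const a))
  let i : El c → El B.carrier := fun x => ⟨x.1, hcB _ x.2⟩
  have hi : Function.Injective i := fun x y h => Subtype.ext (congrArg (fun z => z.1) h)
  have hia (x : El c) : i x ≤ a := (hc _).1 x.2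
  let r : El B.carrier → El c := fun x => ⟨(x ⊓ a).1, (hc _).2 inf_le_right⟩
  have hr : DefinableMap M r := (B.definable_inf hM .id (.const a)).coded
  have hdi : DefinableMap M i := (DefinableMap.id (A := El c)).coded
  have hir (x : El B.carrier) : i (r x) = x ⊓ a := rfl
  have hir' (x : El B.carrier) (h : x ≤ a) : i (r x) = x := (hir x).trans (inf_eq_left.2 h)
  let : Max (El c) := ⟨fun x y => r (i x ⊔ i y)⟩
  let : Min (El c) := ⟨fun x y => r (i x ⊓ i y)⟩
  let : LE (El c) := ⟨fun x y => i x ≤ i y⟩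
  let : LT (El c) := ⟨fun x y => i x < i y⟩
  have hsup (x y : El c) : i (x ⊔ y) = i x ⊔ i y := hir' _ (sup_le (hia x) (hia y))
  have hinf (x y : El c) : i (x ⊓ y) = i x ⊓ i y := hir' _ (inf_le_of_left_le (hia x))
  let : DistribLattice (El c) := hi.distribLattice i Iff.rfl Iff.rfl hsup hinf
  let : BooleanAlgebra (El c) :=
    { (inferInstance : DistribLattice (El c)) with
      top := r ⊤
      bot := r ⊥
      compl := fun x => r (i x)ᶜ
      le_top := fun x => by
        change i x ≤ i (r ⊤)
        rw [hir, top_inf_eq]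
        exact hia x
      bot_le := fun x => by
        change i (r ⊥) ≤ i x
        rw [hir, bot_inf_eq]
        exact bot_le
      inf_compl_le_bot := fun x => by
        change i (x ⊓ r (i x)ᶜ) ≤ i (r ⊥)
        rw [hinf, hir, ← inf_assoc, inf_compl_self]
        simp
      top_le_sup_compl := fun x => by
        change i (r ⊤) ≤ i (x ⊔ r (i x)ᶜ)
        rw [hsup, hir, hir, sup_inf_left, sup_compl_eq_top, top_inf_eq, top_inf_eq]
        exact le_sup_right }
  exact ⟨{
    carrier := c
    sup_internal := hM.isInternalOp_iff.2 (hr.comp₁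
      (B.definable_sup hM (hdi.comp₁ DefinableMap.id.fst) (hdi.comp₁ .snd)))
    inf_internal := hM.isInternalOp_iff.2 (hr.comp₁
      (B.definable_inf hM (hdi.comp₁ DefinableMap.id.fst) (hdi.comp₁ .snd)))
    compl_internal := hM.isInternalMap_iff.2 (hr.comp₁ (B.definable_compl hM hdi)) },
    i, r, hr, hi, hir, fun _ _ => Iff.rfl, hia⟩

/-- The members of `z` in the algebra `B` form a prime ideal. The conditions are chosen so that they
are visibly first-order and directly yield the homomorphism properties of the Stone map;
`sup_mem_iff` includes that the ideal is a lower set. -/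
structure BoolAlg.IsPrimeIdeal (z : M) : Prop where
  top_notMem : ¬ (⊤ : El B.carrier).1 ∈ₘ z
  sup_mem_iff : ∀ x y : El B.carrier, (x ⊔ y).1 ∈ₘ z ↔ x.1 ∈ₘ z ∧ y.1 ∈ₘ z
  inf_mem_iff : ∀ x y : El B.carrier, (x ⊓ y).1 ∈ₘ z ↔ x.1 ∈ₘ z ∨ y.1 ∈ₘ z
  bot_mem : (⊥ : El B.carrier).1 ∈ₘ z

theorem BoolAlg.definable_isPrimeIdeal (hM : ModelsZF M) : DefinablePred M B.IsPrimeIdeal := by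
  have : DefinablePred M fun z : M => ¬ (⊤ : El B.carrier).1 ∈ₘ z ∧
      (∀ x y : El B.carrier, (x ⊔ y).1 ∈ₘ z ↔ x.1 ∈ₘ z ∧ y.1 ∈ₘ z) ∧
      (∀ x y : El B.carrier, (x ⊓ y).1 ∈ₘ z ↔ x.1 ∈ₘ z ∨ y.1 ∈ₘ z) ∧
      (⊥ : El B.carrier).1 ∈ₘ z := by
    have hz : DefinableMap M fun p : (M × El B.carrier) × El B.carrier => p.1.1 :=
      DefinableMap.id.fst.fst
    have hx : DefinableMap M fun p : (M × El B.carrier) × El B.carrier => p.1.2 :=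
      DefinableMap.snd.fst
    have hy : DefinableMap M fun p : (M × El B.carrier) × El B.carrier => p.2 := .snd
    exact .and (.not (.mem (.const _) .id)) (.and
      (.forall (.forall (.iff (.mem (B.definable_sup hM hx hy).coe hz)
        (.and (.mem hx.coe hz) (.mem hy.coe hz)))))
      (.and (.forall (.forall (.iff (.mem (B.definable_inf hM hx hy).coe hz)
        (.or (.mem hx.coe hz) (.mem hy.coe hz))))) (.mem (.const _) .id)))
  exact this.congr fun z => ⟨fun h => ⟨h.1, h.2, h.3, h.4⟩, fun h => ⟨h.1, h.2.1, h.2.2.1, h.2.2.2⟩⟩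

/-- The prime ideals of `B` form a set of the model. -/
theorem BoolAlg.exists_spectrum (hM : ModelsZF M) : ∃ X : M, ∀ z, z ∈ₘ X ↔
    (∀ x, x ∈ₘ z → x ∈ₘ B.carrier) ∧ B.IsPrimeIdeal z := by
  obtain ⟨X, hX⟩ := hM.exists_sep (B.definable_isPrimeIdeal hM) (hM.pow B.carrier)
  exact ⟨X, fun z => (hX z).trans (and_congr_left fun _ => hM.mem_pow)⟩

theorem BoolAlg.exists_isPrimeIdeal_notMem (hM : ModelsZF M) (hP : PrimeIdealTheorem M)
    {a : El B.carrier} (ha : a ≠ ⊥) :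
    ∃ z, (∀ x, x ∈ₘ z → x ∈ₘ B.carrier) ∧ B.IsPrimeIdeal z ∧ ¬ a.1 ∈ₘ z := by
  obtain ⟨C, i, r, hr, hi, hir, hle, hia⟩ := B.exists_relative hM a
  have hri (x) : r (i x) = x := hi ((hir _).trans (inf_eq_left.2 (hia x)))
  have hmono (x y) (h : x ≤ y) : r x ≤ r y := by
    rw [hle, hir, hir]
    exact inf_le_inf_right a h
  have hbot : r ⊥ = ⊥ := le_bot_iff.1 (by
    rw [hle, hir, bot_inf_eq]
    exact bot_le)
  have htop (x) (h : a ≤ x) : r x = ⊤ := top_le_iff.1 (by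
    rw [hle, hir, inf_eq_right.2 h]
    exact hia ⊤)
  have hinf (x y) : r (x ⊓ y) = r x ⊓ r y := by
    refine le_antisymm (le_inf (hmono _ _ inf_le_left) (hmono _ _ inf_le_right)) ?_
    rw [hle, hir]
    refine le_inf (le_inf ?_ ?_) (hia _)
    · exact ((hle _ _).1 inf_le_left).trans ((hir x).trans_le inf_le_left)
    · exact ((hle _ _).1 inf_le_right).trans ((hir y).trans_le inf_le_left)
  have hsup (x y) : r (x ⊔ y) = r x ⊔ r y := by
    refine le_antisymm ?_ (sup_le (hmono _ _ le_sup_left) (hmono _ _ le_sup_right))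
    rw [hle, hir, inf_sup_right, ← hir, ← hir]
    exact sup_le ((hle _ _).1 le_sup_left) ((hle _ _).1 le_sup_right)
  have : Nontrivial (El C.carrier) := ⟨r a, r ⊥, fun h => ha (by
    simpa [hir] using congrArg i h)⟩
  obtain ⟨I, hI, hIM⟩ := hP C this
  -- `r` is a homomorphism onto the relative algebra, so the preimage of `I` is prime; `r a = ⊤`.
  obtain ⟨z, hzB, hz⟩ := hM.exists_subset (Q := fun x : El B.carrier => r x ∈ I)
    ((hM.isInternalSet_iff.1 hIM).comp₁ hr)
  have htopI : (⊤ : El C.carrier) ∉ I := hI.toIsProper.top_notMem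
  refine ⟨z, hzB, ⟨?_, fun x y => ?_, fun x y => ?_, ?_⟩, ?_⟩
  · rwa [hz, htop _ le_top]
  · rw [hz, hz, hz, hsup, Order.Ideal.sup_mem_iff]
  · rw [hz, hz, hz, hinf]
    exact ⟨hI.mem_or_mem, fun h => h.elim (I.lower inf_le_left) (I.lower inf_le_right)⟩
  · rw [hz, hbot]
    exact I.bot_mem
  · rwa [hz, htop _ le_rfl]

/-- The Stone map sends `x` to the set of the prime ideals that omit `x`. -/
theorem BoolAlg.exists_stone (hM : ModelsZF M) (hP : PrimeIdealTheorem M) :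
    ∃ (X : M) (s : El B.carrier → El (hM.powerAlg X).carrier), DefinableMap M s ∧
      (∀ x y, s x ≤ s y ↔ x ≤ y) ∧ (∀ x y, s (x ⊔ y) = s x ⊔ s y) ∧
      ∀ x y, s x ⊓ s y = ⊥ ↔ x ⊓ y = ⊥ := by
  obtain ⟨X, hX⟩ := B.exists_spectrum hM
  have hs (x : El B.carrier) : ∃ t : El (hM.powerAlg X).carrier,
      extent t = {z : El X | ¬ x.1 ∈ₘ z.1} :=
    hM.exists_extent_eq (.not (.mem (.const _) DefinableMap.id.coe))
  -- Choosing `s` outside the model is harmless: extents determine the values, so `s` is definable.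
  choose s hs using hs
  have hsdef : DefinableMap M s := by
    have : DefinablePred M fun p : El B.carrier × El (hM.powerAlg X).carrier =>
        ∀ z : El X, z ∈ extent p.2 ↔ ¬ p.1.1 ∈ₘ z.1 :=
      .forall (.iff (.mem_extent .snd DefinableMap.snd.fst)
        (.not (.mem DefinableMap.id.fst.coe.fst DefinableMap.snd.coe)))
    refine .of_graph (this.congr fun p => ?_)
    rw [eq_comm, hM.eq_iff_extent, hs]
    rfl
  have hsup (x y) : s (x ⊔ y) = s x ⊔ s y := hM.eq_iff_extent.2 fun z => by
    rw [hM.extent_sup, hs, hs, hs]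
    simp [((hX _).1 z.2).2.sup_mem_iff, imp_iff_not_or]
  have hinf (x y) : s (x ⊓ y) = s x ⊓ s y := hM.eq_iff_extent.2 fun z => by
    rw [hM.extent_inf, hs, hs, hs]
    simp [((hX _).1 z.2).2.inf_mem_iff]
  have hbot (x) : s x = ⊥ ↔ x = ⊥ := by
    rw [hM.eq_bot_iff_extent, hs]
    constructor
    · intro h
      by_contra hx
      obtain ⟨z, hzB, hz, hxz⟩ := B.exists_isPrimeIdeal_notMem hM hP hx
      exact (Set.ext_iff.1 h ⟨z, (hX z).2 ⟨hzB, hz⟩⟩).1 hxz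
    · rintro rfl
      refine Set.eq_empty_iff_forall_notMem.2 fun z hz => hz ((hX _).1 z.2).2.bot_mem
  refine ⟨X, s, hsdef, fun x y => ⟨fun h => ?_, fun h => ?_⟩, hsup, fun x y => ?_⟩
  -- `s x ≤ s y` gives `s (x ⊓ yᶜ) ≤ s (y ⊓ yᶜ) = ⊥`, whence `x ⊓ yᶜ = ⊥`.
  · rw [← disjoint_compl_right_iff, disjoint_iff, ← hbot, hinf]
    refine le_bot_iff.1 ((inf_le_inf_right _ h).trans ?_)
    rw [← hinf, inf_compl_self, (hbot ⊥).2 rfl]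
  · rw [← sup_eq_right.2 h, hsup]
    exact le_sup_left
  · rw [← hinf, hbot]

variable {B}

/-- The least weak contact relation on `Q` for which `s` preserves contact. -/
theorem isWeakContact_generated {P Q : Type*} [PartialOrder P] [OrderBot P] [PartialOrder Q]
    [OrderBot Q] {δ : P → P → Prop} (hδ : IsWeakContact δ) {s : P → Q}
    (hs : ∀ x, s x = ⊥ → x = ⊥) :
    IsWeakContact fun a b : Q => Overlap a b ∨ ∃ x y, δ x y ∧ s x ≤ a ∧ s y ≤ b where
  ne_bot := by
    rintro a b (h | ⟨x, y, h, hx, hy⟩)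
    · exact isWeakContact_overlap.ne_bot _ _ h
    · exact ⟨fun ha => (hδ.ne_bot _ _ h).1 (hs x (le_bot_iff.1 (ha ▸ hx))),
        fun hb => (hδ.ne_bot _ _ h).2 (hs y (le_bot_iff.1 (hb ▸ hy)))⟩
  refl a ha := .inl (isWeakContact_overlap.refl a ha)
  symm := by
    rintro a b (h | ⟨x, y, h, hx, hy⟩)
    · exact .inl (isWeakContact_overlap.symm _ _ h)
    · exact .inr ⟨y, x, hδ.symm _ _ h, hy, hx⟩
  ext := by
    rintro a b a' b' (h | ⟨x, y, h, hx, hy⟩) ha hb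
    · exact .inl (isWeakContact_overlap.ext _ _ _ _ h ha hb)
    · exact .inr ⟨x, y, h, hx.trans ha, hy.trans hb⟩

theorem WCSemilattice.EmbedsInto.trans {S : WCSemilattice M} {B C : WCBoolAlg M}
    (h : S.EmbedsInto B) (hM : ModelsZF M) {s : El B.carrier → El C.carrier} (hs : DefinableMap M s)
    (hinj : Function.Injective s) (hsup : ∀ x y, s (x ⊔ y) = s x ⊔ s y)
    (hrel : ∀ x y, B.rel x y ↔ C.rel (s x) (s y)) : S.EmbedsInto C := by
  obtain ⟨f, hf, hfinj, hfsup, hfrel⟩ := h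
  refine ⟨fun x => s (f x), hM.isInternalMap_iff.2 (hs.comp₁ (hM.isInternalMap_iff.1 hf)),
    hinj.comp hfinj, fun x y => ?_, fun x y => (hfrel x y).trans (hrel _ _)⟩
  change s (f (x ⊔ y)) = s (f x) ⊔ s (f y)
  rw [hfsup, hsup]

end Stone

/-! ### The Prime Ideal Theorem implies the two embedding statements -/

section Equivalence

variable {M : Type u} [LSet.Structure M]

theorem PrimeIdealTheorem.weakContactImplication (hP : PrimeIdealTheorem M) (hM : ModelsZF M) :
    WeakContactImplication M := by
  rintro S ⟨B, hSB⟩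
  obtain ⟨X, s, hs, hle, hsup, hinf⟩ := B.exists_stone hM hP
  have hinj : Function.Injective s := fun x y h => le_antisymm ((hle _ _).1 h.le) ((hle _ _).1 h.ge)
  have hbot (x) (hx : s x = ⊥) : x = ⊥ := by simpa using (hinf x x).1 (by simp [hx])
  let C : WCBoolAlg M :=
    { hM.powerAlg X with
      rel := fun a b => Overlap a b ∨ ∃ x y, B.rel x y ∧ s x ≤ a ∧ s y ≤ b
      rel_internal := hM.isInternalRel_iff.2 (.or
        (hM.isInternalRel_iff.1 ((hM.powerAlg X).isInternalRel_overlap hM))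
        (.exists (.exists (.and ((hM.isInternalRel_iff.1 B.rel_internal).comp₂
            DefinableMap.snd.fst .snd)
          (.and ((hM.powerAlg X).definable_le hM (hs.comp₁ DefinableMap.snd.fst)
              DefinableMap.id.fst.fst.fst)
            ((hM.powerAlg X).definable_le hM (hs.comp₁ .snd) DefinableMap.snd.fst.fst))))))
      rel_contact := isWeakContact_generated B.rel_contact hbot }
  refine ⟨C, hM.powerAlg_isComplete, hM.powerAlg_isAtomic,
    hSB.trans hM (C := C) hs hinj hsup fun x y => ⟨fun h => .inr ⟨x, y, h, le_rfl, le_rfl⟩, ?_⟩⟩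
  rintro (h | ⟨x', y', h, hx, hy⟩)
  · have hxy : x ⊓ y ≠ ⊥ := fun h' => overlap_iff_inf_ne_bot.1 h ((hinf x y).2 h')
    exact B.rel_contact.ext _ _ _ _ (B.rel_contact.refl _ hxy) inf_le_left inf_le_right
  · exact B.rel_contact.ext _ _ _ _ h ((hle _ _).1 hx) ((hle _ _).1 hy)

theorem PrimeIdealTheorem.overlapContactImplication (hP : PrimeIdealTheorem M) (hM : ModelsZF M) :
    OverlapContactImplication M := by
  rintro S ⟨B, hB, hSB⟩
  obtain ⟨X, s, hs, hle, hsup, hinf⟩ := B.exists_stone hM hP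
  refine ⟨(hM.powerAlg X).overlapAlg hM, fun _ _ => Iff.rfl, hM.powerAlg_isComplete,
    hM.powerAlg_isAtomic, hSB.trans hM (C := (hM.powerAlg X).overlapAlg hM) hs
      (fun x y h => le_antisymm ((hle _ _).1 h.le) ((hle _ _).1 h.ge)) hsup fun x y => ?_⟩
  rw [hB, overlap_iff_inf_ne_bot, ne_eq, ← hinf]
  exact overlap_iff_inf_ne_bot.symm

end Equivalence

end ZFContact

theorem proposition3p3 {M : Type*} [ZFContact.LSet.Structure M] (hM : ZFContact.ModelsZF M) :
    [ZFContact.PrimeIdealTheorem M, ZFContact.WeakContactImplication M,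
      ZFContact.OverlapContactImplication M].TFAE := by
  tfae_have 1 → 2 := fun h => h.weakContactImplication hM
  tfae_have 1 → 3 := fun h => h.overlapContactImplication hM
  tfae_have 2 → 1 := fun h B _ => by
    obtain ⟨C, -, hC, hBC⟩ := h _ ⟨_, B.overlapSemilattice_embedsInto hM⟩
    exact B.exists_prime_of_embedsInto hM hBC
  tfae_have 3 → 1 := fun h B _ => by
    obtain ⟨C, -, -, hC, hBC⟩ :=
      h _ ⟨_, fun _ _ => Iff.rfl, B.overlapSemilattice_embedsInto hM⟩
    exact B.exists_prime_of_embedsInto hM hBC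
  tfae_finish
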